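/- **Open non-preemptive online dial-a-ride.** Let $(M,d)$ be a metric space with a point $o\in M$, the origin, and let $c\in\{1,2,\dots\}\cup\{\infty\}$. Finitely many requests $r_i=(a_i,b_i;t_i)$ with $a_i,b_i\in M$ and $t_i\ge 0$ are given; $r_i$ becomes known at its release time $t_i$. A server that moves at unit speed, and is empty and in $o$ at time $0$, has to load every request $r_i$ in $a_i$ not before time $t_i$ and to unload it later in $b_i$; it never carries more than $c$ requests and unloads a request only at its destination. It may finish anywhere. The cost is the time when all requests are served. Travelling from $x$ to $y$ takes time $d(x,y)$; while under way the server is a point of a geodesic space that contains $M$ isometrically ($M$ itself if $M$ is geodesic). Let $\mathrm{Opt}(\sigma)$ be the least cost of an offline schedule for the request sequence $\sigma$, and $\mathrm{Opt}(t)$ the least cost of an offline schedule for the requests released not later than time $t$. **The algorithm $\mathrm{Lazy}(\alpha)$.** *Whenever requests are released*, at time $t$: if the server can deliver all requests on board and return to $o$ until time $\alpha\cdot\mathrm{Opt}(t)$, it aborts what it is doing and does this in the fastest possible way; otherwise it goes on with what it is doing. *Whenever it is idle*, at time $t$: if $t<\alpha\cdot\mathrm{Opt}(t)$, it waits where it is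 until time $\alpha\cdot\mathrm{Opt}(t)$; otherwise, if there are released and unserved requests, it follows a shortest schedule that serves all of them from its current position. An algorithm $\mathrm{Alg}$ is $\rho$-competitive on general metric spaces if on every metric space, for every origin and every request sequence $\sigma$, it serves all requests and its cost satisfies $\mathrm{Alg}(\sigma)\le\rho\cdot\mathrm{Opt}(\sigma)$. Its competitive ratio is the infimum of all $\rho\ge 1$ for which it is $\rho$-competitive. **Theorem.** Let $\alpha=\frac12+\sqrt{11/12}$. For every capacity $c\in\{1,2,\dots\}\cup\{\infty\}$, the competitive ratio of $\mathrm{Lazy}(\alpha)$ for the open non-preemptive online dial-a-ride problem on general metric spaces is exactly $\alpha+1\approx 2.457$. This holds however ties between shortest schedules, between shortest paths and between simultaneous events are broken. -/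

import Mathlib

universe u v

noncomputable section

namespace DialARide

/-- A transportation request `(a, b; t)`: bring an item from `source = a` to `target = b`;
it becomes known, and may be loaded, at time `release = t ≥ 0`. -/
structure Request (M : Type u) where
  source : M
  target : M
  release : ℝ
  release_nonneg : 0 ≤ release

/-- The same request with its two places read in a space `X`. -/
def Request.map {M : Type u} {X : Type v} (f : M → X) (q : Request M) : Request X where
  source := f q.source
  target := f q.target
  release := q.release
  release_nonneg := q.release_nonneg

/-- What a server with `n` requests can be told to do: go to the source of request `i` and load it,
go to the target of request `i` and unload it, or go to the origin. -/
inductive Action (n : ℕ) where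
  | load (i : Fin n)
  | unload (i : Fin n)
  | home

/-- The place where an action is carried out (`o` is the origin). -/
def Action.place {M : Type u} {n : ℕ} (o : M) (r : Fin n → Request M) : Action n → M
  | .load i => (r i).source
  | .unload i => (r i).target
  | .home => o

/-- `Serves c W L as`: a server of capacity `c` that carries exactly the requests in `L` serves, by
the actions `as`, exactly the requests in `W ∪ L`: each request of `W` is loaded once, each loaded
request is unloaded once, at its target only (no preemption), and never more than `c` requests are
on board. -/
inductive Serves {n : ℕ} (c : ℕ∞) : Finset (Fin n) → Finset (Fin n) → List (Action n) → Prop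
  | done : Serves c ∅ ∅ []
  | load {W L : Finset (Fin n)} {i : Fin n} {as : List (Action n)} (hi : i ∈ W)
      (hcap : (L.card : ℕ∞) + 1 ≤ c) (h : Serves c (W.erase i) (insert i L) as) :
      Serves c W L (.load i :: as)
  | unload {W L : Finset (Fin n)} {i : Fin n} {as : List (Action n)} (hi : i ∈ L)
      (h : Serves c W (L.erase i) as) :
      Serves c W L (.unload i :: as)

section Offline

variable {M : Type u} [MetricSpace M] {n : ℕ}

/-- The distance travelled from `x` when the actions are carried out one after the other. -/
def routeLength (o : M) (r : Fin n → Request M) : M → List (Action n) → ℝ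
  | _, [] => 0
  | x, a :: as => dist x (a.place o r) + routeLength o r (a.place o r) as

/-- The earliest time at which an action is allowed: a request cannot be loaded before its
release. -/
def Action.allowedFrom (r : Fin n → Request M) : Action n → ℝ
  | .load i => (r i).release
  | .unload _ => 0
  | .home => 0

/-- `Executable o r t x as`: a server of unit speed that is in `x` at time `t` can carry out the
actions listed in `as` at the times listed with them. -/
def Executable (o : M) (r : Fin n → Request M) : ℝ → M → List (Action n × ℝ) → Prop
  | _, _, [] => True
  | t, x, (a, s) :: as =>
      t + dist x (a.place o r) ≤ s ∧ a.allowedFrom r ≤ s ∧ Executable o r s (a.place o r) as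

/-- The time of the last action of a timed schedule that begins at time `t`. -/
def finishTime : ℝ → List (Action n × ℝ) → ℝ
  | t, [] => t
  | _, (_, s) :: as => finishTime s as

/-- The offline optimum for the requests in `A`: the least completion time of a schedule that
begins in the origin at time `0`, respects release times and capacity, and serves all of `A`. -/
def opt (c : ℕ∞) (o : M) (r : Fin n → Request M) (A : Finset (Fin n)) : ℝ :=
  sInf {T : ℝ | ∃ as : List (Action n × ℝ),
    Serves c A ∅ (as.map Prod.fst) ∧ Executable o r 0 o as ∧ finishTime 0 as = T}

/-- `as` is a shortest schedule that serves `R` from the point `x`, release times ignored. -/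
def IsShortestSchedule (c : ℕ∞) (o : M) (r : Fin n → Request M) (R : Finset (Fin n)) (x : M)
    (as : List (Action n)) : Prop :=
  Serves c R ∅ as ∧ ∀ bs, Serves c R ∅ bs → routeLength o r x as ≤ routeLength o r x bs

/-- `as` delivers the loaded requests `L` from the point `x` in such an order that the tour through
their targets and then to the origin is shortest. -/
def IsFastestDelivery (c : ℕ∞) (o : M) (r : Fin n → Request M) (L : Finset (Fin n)) (x : M)
    (as : List (Action n)) : Prop :=
  Serves c ∅ L as ∧
    ∀ bs, Serves c ∅ L bs → routeLength o r x (as ++ [.home]) ≤ routeLength o r x (bs ++ [.home])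

end Offline

/-- The requests released not later than time `t`. -/
def released {X : Type u} {n : ℕ} (r : Fin n → Request X) (t : ℝ) : Finset (Fin n) :=
  open Classical in Finset.univ.filter fun i => (r i).release ≤ t

/-- The state of the online server: current time and position, the requests it has received so far,
those on board, those served, and the actions that remain of the command it is executing. The server
is idle, or waiting, when `plan = []`. -/
structure ServerState (X : Type u) (n : ℕ) where
  time : ℝ
  pos : X
  seen : Finset (Fin n)
  loaded : Finset (Fin n)
  served : Finset (Fin n)
  plan : List (Action n)

namespace ServerState

variable {X : Type u} {n : ℕ}

/-- At time `0` the server is empty and idle in the origin and knows no request. -/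
def init (o : X) : ServerState X n where
  time := 0
  pos := o
  seen := ∅
  loaded := ∅
  served := ∅
  plan := []

/-- The requests received but not yet served. -/
def unserved (s : ServerState X n) : Finset (Fin n) := s.seen \ s.served

/-- The requests on board after an action. -/
def loadedAfter (s : ServerState X n) : Action n → Finset (Fin n)
  | .load i => insert i s.loaded
  | .unload i => s.loaded.erase i
  | .home => s.loaded

/-- The requests served after an action. -/
def servedAfter (s : ServerState X n) : Action n → Finset (Fin n)
  | .load _ => s.served
  | .unload i => insert i s.served
  | .home => s.served

/-- `t` is the release time of the next requests still to be received. -/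
def IsNextRelease (r : Fin n → Request X) (s : ServerState X n) (t : ℝ) : Prop :=
  (∃ i, i ∉ s.seen ∧ (r i).release = t) ∧ ∀ i, i ∉ s.seen → t ≤ (r i).release

end ServerState

/-- One step of the algorithm `Lazy(α)` for a server of capacity `c` and origin `o`. -/
inductive LazyStep {X : Type u} [MetricSpace X] {n : ℕ} (α : ℝ) (c : ℕ∞) (o : X)
    (r : Fin n → Request X) : ServerState X n → ServerState X n → Prop
  /-- Requests arrive, and the server can deliver what is on board and be back in the origin by time
  `α * Opt(t)`: it aborts what it is doing and does so in the fastest way. -/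
  | deliverAndReturn (s : ServerState X n) (as : List (Action n))
      (hnew : ∃ i, i ∉ s.seen ∧ (r i).release ≤ s.time)
      (has : IsFastestDelivery c o r s.loaded s.pos as)
      (hback : s.time + routeLength o r s.pos (as ++ [.home])
        ≤ α * opt c o r (released r s.time)) :
      LazyStep α c o r s { s with seen := released r s.time, plan := as ++ [.home] }
  /-- Requests arrive, and the server cannot deliver what is on board and be back in the origin by
  time `α * Opt(t)`: it goes on with what it is doing. -/
  | carryOn (s : ServerState X n)
      (hnew : ∃ i, i ∉ s.seen ∧ (r i).release ≤ s.time)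
      (hlate : ∀ as, Serves c ∅ s.loaded as →
        α * opt c o r (released r s.time) < s.time + routeLength o r s.pos (as ++ [.home])) :
      LazyStep α c o r s { s with seen := released r s.time }
  /-- No request arrives before the server has reached the place of its next action; it carries out
  the action there. -/
  | arrive (s : ServerState X n) (a : Action n) (as : List (Action n))
      (hplan : s.plan = a :: as)
      (hquiet : ∀ i, i ∉ s.seen → s.time + dist s.pos (a.place o r) ≤ (r i).release) :
      LazyStep α c o r s
        { s with
          time := s.time + dist s.pos (a.place o r)
          pos := a.place o r
          loaded := s.loadedAfter a
          served := s.servedAfter a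
          plan := as }
  /-- The next requests arrive at time `t`, when the server is in a point `z` on a shortest path to
  the place of its next action. -/
  | travel (s : ServerState X n) (a : Action n) (as : List (Action n)) (t : ℝ) (z : X)
      (hplan : s.plan = a :: as)
      (hnext : s.IsNextRelease r t) (hlt : s.time < t)
      (hle : t ≤ s.time + dist s.pos (a.place o r))
      (hz : dist s.pos z = t - s.time)
      (hz' : dist z (a.place o r) = dist s.pos (a.place o r) - (t - s.time)) :
      LazyStep α c o r s { s with time := t, pos := z }
  /-- The server is idle, and the next requests arrive while it has nothing to serve or has to wait
  until time `α * Opt(t)`. -/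
  | wait (s : ServerState X n) (t : ℝ)
      (hplan : s.plan = [])
      (hnext : s.IsNextRelease r t) (hlt : s.time < t)
      (hwait : s.unserved = ∅ ∨ t ≤ max s.time (α * opt c o r s.seen)) :
      LazyStep α c o r s { s with time := t }
  /-- The server is idle and has unserved requests, and no request arrives until time `α * Opt(t)`
  (or the present time, if that is later); then it starts a shortest schedule from where it is. -/
  | start (s : ServerState X n) (as : List (Action n))
      (hplan : s.plan = [])
      (hquiet : ∀ i, i ∉ s.seen → max s.time (α * opt c o r s.seen) < (r i).release)
      (hne : s.unserved.Nonempty)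
      (has : IsShortestSchedule c o r s.unserved s.pos as) :
      LazyStep α c o r s { s with time := max s.time (α * opt c o r s.seen), plan := as }

/-- Every execution of `Lazy(α)` from the state `s`, however ties are broken, serves all requests
after finitely many steps, and not later than time `T`. -/
inductive AlwaysFinishesBy {X : Type u} [MetricSpace X] {n : ℕ} (α : ℝ) (c : ℕ∞) (o : X)
    (r : Fin n → Request X) (T : ℝ) : ServerState X n → Prop
  | done (s : ServerState X n) (hserved : s.served = Finset.univ) (htime : s.time ≤ T) :
      AlwaysFinishesBy α c o r T s
  | step (s : ServerState X n) (hex : ∃ s', LazyStep α c o r s s')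
      (hall : ∀ s', LazyStep α c o r s s' → AlwaysFinishesBy α c o r T s') :
      AlwaysFinishesBy α c o r T s

/-- Some execution of `Lazy(α)` from the state `s` serves all requests, and not later than
time `T`. -/
def CanFinishBy {X : Type u} [MetricSpace X] {n : ℕ} (α : ℝ) (c : ℕ∞) (o : X)
    (r : Fin n → Request X) (T : ℝ) (s : ServerState X n) : Prop :=
  ∃ s', Relation.ReflTransGen (LazyStep α c o r) s s' ∧ s'.served = Finset.univ ∧ s'.time ≤ T

/-- Any two points are joined by a path whose length is their distance. -/
def IsGeodesicSpace (X : Type u) [MetricSpace X] : Prop :=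
  ∀ x y : X, ∃ γ : ℝ → X, γ 0 = x ∧ γ (dist x y) = y ∧
    ∀ s ∈ Set.Icc 0 (dist x y), ∀ t ∈ Set.Icc 0 (dist x y), dist (γ s) (γ t) = |s - t|

/-- `Lazy(α)` is `ρ`-competitive with capacity `c` on general metric spaces, however its ties are
broken. The origin and the requests lie in an arbitrary metric space `M`. While the server is on its
way between two points of `M` at unit speed, it is a point of a geodesic space `X` that contains `M`
isometrically: `M` itself if `M` is geodesic, otherwise any such space, for example the complete
graph on `M` with edges of length `dist x y`. -/
def CompetitiveForAllTies (α : ℝ) (c : ℕ∞) (ρ : ℝ) : Prop :=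
  ∀ (M X : Type u) [MetricSpace M] [MetricSpace X] (e : M → X), Isometry e → IsGeodesicSpace X →
    ∀ (o : M) (n : ℕ) (r : Fin n → Request M),
      AlwaysFinishesBy α c (e o) (fun i => (r i).map e) (ρ * opt c o r Finset.univ)
        (ServerState.init (e o))

/-- `Lazy(α)` is `ρ`-competitive with capacity `c` on general metric spaces if its ties are broken
in the most favourable way on every single request sequence. -/
def CompetitiveForBestTies (α : ℝ) (c : ℕ∞) (ρ : ℝ) : Prop :=
  ∀ (M X : Type u) [MetricSpace M] [MetricSpace X] (e : M → X), Isometry e → IsGeodesicSpace X →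
    ∀ (o : M) (n : ℕ) (r : Fin n → Request M),
      CanFinishBy α c (e o) (fun i => (r i).map e) (ρ * opt c o r Finset.univ)
        (ServerState.init (e o))

end DialARide

end

/-!
Lower bound: a single request on the real line, at distance `1` from the origin and released at
time `0`, has optimum `1`. `Lazy(α)` waits in the origin until time `α` and is done at `α + 1`.

Upper bound: a *phase* (`IsPhase`) begins whenever the server starts a schedule for the unserved
requests. If this happens at time `t`, the schedule has length `S`, and `O` is the optimum for the
requests received so far, then `α * O ≤ t`, and the claim to be kept up is `t + S ≤ (1 + α) * O`; it
implies `S ≤ O`. For a phase that begins in the origin it holds since `t = α * O` and `S ≤ O`. A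
phase that begins elsewhere, in the end `p'` of the previous schedule, needs an argument. Let `t`,
`S`, `O` belong to the previous phase, and let `O'` be the new optimum. When the new requests came,
the server could not be back in the origin by time `α * O'`. Since `p'` has distance at most `O`
from the origin, this gives `O' ≤ 2 * α * O ≤ 2 * t` (`Away.carryOn`).

The new requests are released after `t`. Cut an optimal schedule at the time `τ > t` when it loads
the first of them, in `a`. From there it serves all of them in time `O' - τ`, so the next schedule
has length at most `dist p' a + O' - τ`.
* If the next phase begins at time `α * O'`, it remains to see that `dist p' a ≤ τ`. This is clear
  if the optimum visits `p'` before `a`. If it visits `p'` after `a`, then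
  `dist p' a ≤ O' - τ ≤ 2 * t - τ ≤ τ`.
* If the next phase begins at time `t + S`, it remains to see that `t + S + dist p' a - τ ≤ α * O'`.
  The hard case is that the optimum visits `p'` before `a`, at an early time `θ`. If the previous
  phase began away from the origin, its requests were released at time `O / 2` or later, so `θ` is
  not early enough to do harm. If it began in the origin and the optimum visits one of its places
  after `a`, then the distance from `a` to `p'` is bounded by way of this place. Otherwise the
  optimum serves all requests of the previous phase before `a`, in another order and ending in a
  place `q`, say. Then `p'` and `q` cannot be as far from each other as a violation requires, as both
  would have to be close to the origin.

This is `IsPhase.exists_serves_next`; the value of `α` enters as `3 * α ^ 2 = 3 * α + 2`, that is,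
`α * (α - 1) = 2 / 3`, which in the last case is exactly what is needed.

`LazyInvariant` says that the server is idle in the origin, or on its way there and in time, or in a
phase. Every step keeps it (`LazyInvariant.step`) and decreases a lexicographic measure
(`LazyStep.measure_lt`), and a step is possible until all requests are served (`exists_lazyStep`).
-/

namespace DialARide

/-! ### Schedules as lists of actions -/

instance (n : ℕ) : Finite (Action n) :=
  Finite.of_surjective
    (fun x : Option (Fin n ⊕ Fin n) => match x with
      | none => Action.home
      | some (.inl i) => Action.load i
      | some (.inr i) => Action.unload i)
    fun a => match a with
      | .home => ⟨none, rfl⟩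
      | .load i => ⟨some (.inl i), rfl⟩
      | .unload i => ⟨some (.inr i), rfl⟩

/-- Whether an action loads or unloads one of the requests in `R`. -/
def Action.concerns {n : ℕ} (R : Finset (Fin n)) : Action n → Bool
  | .load i => decide (i ∈ R)
  | .unload i => decide (i ∈ R)
  | .home => false

namespace Serves

variable {n : ℕ} {c : ℕ∞} {W L R : Finset (Fin n)} {as : List (Action n)} {i : Fin n}

/-- Leaving out all requests outside `R` turns a schedule into a schedule for the rest: the load
only becomes smaller. -/
theorem filter (h : Serves c W L as) (R : Finset (Fin n)) :
    Serves c (W ∩ R) (L ∩ R) (as.filter (Action.concerns R)) := by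
  induction h with
  | done => simpa using Serves.done
  | @load W L i as hi hcap h ih =>
    by_cases hR : i ∈ R
    · rw [List.filter_cons_of_pos (by simpa [Action.concerns] using hR)]
      refine .load (Finset.mem_inter.2 ⟨hi, hR⟩) (le_trans ?_ hcap) ?_
      · gcongr
        exact Finset.inter_subset_left
      · rwa [Finset.erase_inter, Finset.insert_inter_of_mem hR] at ih
    · rw [List.filter_cons_of_neg (by simpa [Action.concerns] using hR)]
      rwa [Finset.erase_inter, Finset.insert_inter_of_notMem hR,
        Finset.erase_eq_of_notMem (by simp [hR])] at ih
  | @unload W L i as hi h ih =>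
    by_cases hR : i ∈ R
    · rw [List.filter_cons_of_pos (by simpa [Action.concerns] using hR)]
      refine .unload (Finset.mem_inter.2 ⟨hi, hR⟩) ?_
      rwa [Finset.erase_inter] at ih
    · rw [List.filter_cons_of_neg (by simpa [Action.concerns] using hR)]
      rwa [Finset.erase_inter, Finset.erase_eq_of_notMem (by simp [hR])] at ih

theorem length_le (h : Serves c W L as) : as.length ≤ 2 * W.card + L.card := by
  induction h with
  | done => simp
  | @load W L i as hi hcap h ih =>
    have h1 := Finset.card_erase_add_one hi
    have h2 := Finset.card_insert_le i L
    simp only [List.length_cons]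
    omega
  | @unload W L i as hi h ih =>
    have h1 := Finset.card_erase_add_one hi
    simp only [List.length_cons]
    omega

theorem finite_setOf (c : ℕ∞) (W L : Finset (Fin n)) : {as | Serves c W L as}.Finite :=
  (List.finite_length_le (Action n) (2 * W.card + L.card)).subset fun _ h => length_le h

theorem exists_deliver (c : ℕ∞) (L : Finset (Fin n)) : ∃ as, Serves c ∅ L as := by
  induction L using Finset.induction_on with
  | empty => exact ⟨[], .done⟩
  | insert i L hi ih =>
    obtain ⟨as, h⟩ := ih
    exact ⟨.unload i :: as, .unload (Finset.mem_insert_self i L)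
      (by rwa [Finset.erase_insert hi])⟩

theorem exists_of_one_le (hc : 1 ≤ c) (W : Finset (Fin n)) : ∃ as, Serves c W ∅ as := by
  induction W using Finset.induction_on with
  | empty => exact ⟨[], .done⟩
  | insert i W hi ih =>
    obtain ⟨as, h⟩ := ih
    refine ⟨.load i :: .unload i :: as, .load (Finset.mem_insert_self i W) (by simpa using hc)
      (.unload (Finset.mem_insert_self i ∅) ?_)⟩
    rw [Finset.erase_insert hi, Finset.erase_insert (Finset.notMem_empty i)]
    exact h

theorem load_mem_iff (h : Serves c W L as) : Action.load i ∈ as ↔ i ∈ W := by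
  induction h with
  | done => simp
  | @load W L j as hj hcap h ih =>
    by_cases hij : i = j
    · simp [hij, hj]
    · simp [ih, hij]
  | @unload W L j as hj h ih => simp [ih]

theorem unload_mem_iff (h : Serves c W L as) : Action.unload i ∈ as ↔ i ∈ W ∪ L := by
  induction h with
  | done => simp
  | @load W L j as hj hcap h ih =>
    by_cases hij : i = j
    · subst hij
      simp [ih, hj]
    · simp [ih, hij]
  | @unload W L j as hj h ih =>
    by_cases hij : i = j
    · simp [hij, hj]
    · simp [ih, hij]

theorem load_unload_sublist (h : Serves c W L as) (hi : i ∈ W) :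
    List.Sublist [.load i, .unload i] as := by
  induction h with
  | done => simp at hi
  | @load W L j as hj hcap h ih =>
    by_cases hij : i = j
    · subst hij
      refine List.Sublist.cons_cons _ (List.singleton_sublist.2 (h.unload_mem_iff.2 ?_))
      simp
    · exact (ih (by simp [hij, hi])).cons _
  | @unload W L j as hj h ih => exact (ih hi).cons _

theorem eq_nil (h : Serves c ∅ ∅ as) : as = [] := by
  cases h with
  | done => rfl
  | load hi => simp at hi
  | unload hi => simp at hi

theorem of_nil (h : Serves c W L []) : W = ∅ ∧ L = ∅ := by
  cases h
  exact ⟨rfl, rfl⟩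

end Serves

/-! ### Routes and timed schedules -/

section Routes

variable {X : Type u} {n : ℕ} {c : ℕ∞} {o : X} {r : Fin n → Request X}

/-- The place where a server that starts in `x` is after the given actions. -/
def routeEnd (o : X) (r : Fin n → Request X) : X → List (Action n) → X
  | x, [] => x
  | _, a :: as => routeEnd o r (a.place o r) as

theorem Serves.routeEnd_eq_target {W L : Finset (Fin n)} {as : List (Action n)}
    (h : Serves c W L as) (hne : (W ∪ L).Nonempty) (x : X) :
    ∃ j ∈ W ∪ L, routeEnd o r x as = (r j).target := by
  induction h generalizing x with
  | done => simp at hne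
  | @load W L i as hi hcap h ih =>
    obtain ⟨j, hj, he⟩ := ih ⟨i, by simp⟩ ((Action.load i).place o r)
    refine ⟨j, ?_, he⟩
    by_cases hij : j = i
    · simp [hij, hi]
    · simpa [hij] using hj
  | @unload W L i as hi h ih =>
    by_cases hne' : (W ∪ L.erase i).Nonempty
    · obtain ⟨j, hj, he⟩ := ih hne' ((Action.unload i).place o r)
      refine ⟨j, ?_, he⟩
      simp only [Finset.mem_union, Finset.mem_erase] at hj ⊢
      tauto
    · rw [Finset.not_nonempty_iff_eq_empty, Finset.union_eq_empty] at hne'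
      rw [hne'.1, hne'.2] at h
      exact ⟨i, by simp [hi], by simp [h.eq_nil, routeEnd, Action.place]⟩

variable [MetricSpace X]

theorem routeLength_append (x : X) (as bs : List (Action n)) :
    routeLength o r x (as ++ bs) =
      routeLength o r x as + routeLength o r (routeEnd o r x as) bs := by
  induction as generalizing x with
  | nil => simp [routeLength, routeEnd]
  | cons a as ih => simp [routeLength, routeEnd, ih, add_assoc]

theorem dist_routeEnd_le (x : X) (as : List (Action n)) :
    dist x (routeEnd o r x as) ≤ routeLength o r x as := by
  induction as generalizing x with
  | nil => simp [routeLength, routeEnd]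
  | cons a as ih =>
    have h1 := ih (a.place o r)
    have h2 := dist_triangle x (a.place o r) (routeEnd o r (a.place o r) as)
    simp only [routeLength, routeEnd]
    linarith

theorem routeLength_nonneg (x : X) (as : List (Action n)) : 0 ≤ routeLength o r x as :=
  dist_nonneg.trans (dist_routeEnd_le x as)

theorem dist_add_dist_routeEnd_le {a : Action n} {as : List (Action n)} (ha : a ∈ as) (x : X) :
    dist x (a.place o r) + dist (a.place o r) (routeEnd o r x as) ≤ routeLength o r x as := by
  induction as generalizing x with
  | nil => simp at ha
  | cons b as ih =>
    simp only [routeLength, routeEnd]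
    rcases List.mem_cons.1 ha with rfl | ha
    · have := dist_routeEnd_le (o := o) (r := r) (a.place o r) as
      linarith
    · have h1 := ih ha (b.place o r)
      have h2 := dist_triangle x (b.place o r) (a.place o r)
      linarith

theorem routeLength_le_dist_add (x y : X) (as : List (Action n)) :
    routeLength o r x as ≤ dist x y + routeLength o r y as := by
  cases as with
  | nil => simp [routeLength]
  | cons a as =>
    have := dist_triangle x y (a.place o r)
    simp only [routeLength]
    linarith

theorem routeLength_le_of_sublist {as bs : List (Action n)} (h : as.Sublist bs) (x : X) :
    routeLength o r x as ≤ routeLength o r x bs := by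
  induction h generalizing x with
  | slnil => simp
  | @cons as bs b h ih =>
    have h1 := ih (b.place o r)
    have h2 := routeLength_le_dist_add (o := o) (r := r) x (b.place o r) as
    simp only [routeLength]
    linarith
  | @cons_cons as bs b h ih =>
    have h1 := ih (b.place o r)
    simp only [routeLength]
    linarith

theorem le_finishTime_of_executable {t : ℝ} {x : X} {as : List (Action n × ℝ)}
    (h : Executable o r t x as) :
    t + routeLength o r x (as.map Prod.fst) ≤ finishTime t as := by
  induction as generalizing t x with
  | nil => simp [routeLength, finishTime]
  | cons e as ih =>
    obtain ⟨a, s⟩ := e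
    obtain ⟨h1, -, h3⟩ := h
    have := ih h3
    simp only [List.map_cons, routeLength, finishTime]
    linarith

/-- By the triangle inequality, actions of a timed schedule may be left out. -/
theorem Executable.of_sublist {t t' : ℝ} {x y : X} {as bs : List (Action n × ℝ)}
    (h : as.Sublist bs) (hb : Executable o r t x bs) (hty : t' + dist y x ≤ t) :
    Executable o r t' y as := by
  induction h generalizing t t' x y with
  | slnil => trivial
  | @cons as bs e h ih =>
    obtain ⟨a, s⟩ := e
    obtain ⟨h1, h2, h3⟩ := hb
    refine ih h3 ?_
    have := dist_triangle y x (a.place o r)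
    linarith
  | @cons_cons as bs e h ih =>
    obtain ⟨a, s⟩ := e
    obtain ⟨h1, h2, h3⟩ := hb
    have := dist_triangle y x (a.place o r)
    exact ⟨by linarith, h2, ih h3 (by simp)⟩

theorem Executable.sublist {t : ℝ} {x : X} {as bs : List (Action n × ℝ)}
    (hb : Executable o r t x bs) (h : as.Sublist bs) : Executable o r t x as :=
  hb.of_sublist h (by simp)

theorem finishTime_le_of_sublist {t t' : ℝ} {x : X} {as bs : List (Action n × ℝ)}
    (h : as.Sublist bs) (hb : Executable o r t x bs) (ht : t' ≤ t) :
    finishTime t' as ≤ finishTime t bs := by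
  induction h generalizing t t' x with
  | slnil => exact ht
  | @cons as bs e h ih =>
    obtain ⟨a, s⟩ := e
    obtain ⟨h1, h2, h3⟩ := hb
    exact ih h3 (by linarith [dist_nonneg (x := x) (y := a.place o r)])
  | @cons_cons as bs e h ih =>
    obtain ⟨a, s⟩ := e
    obtain ⟨h1, h2, h3⟩ := hb
    exact ih h3 le_rfl

theorem finishTime_append (t : ℝ) (as bs : List (Action n × ℝ)) :
    finishTime t (as ++ bs) = finishTime (finishTime t as) bs := by
  induction as generalizing t with
  | nil => rfl
  | cons e as ih => exact ih e.2

/-- The schedule that carries out the given actions as early as possible. -/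
noncomputable def earliest (o : X) (r : Fin n → Request X) :
    ℝ → X → List (Action n) → List (Action n × ℝ)
  | _, _, [] => []
  | t, x, a :: as =>
      (a, max (t + dist x (a.place o r)) (a.allowedFrom r)) ::
        earliest o r (max (t + dist x (a.place o r)) (a.allowedFrom r)) (a.place o r) as

theorem map_fst_earliest (t : ℝ) (x : X) (as : List (Action n)) :
    (earliest o r t x as).map Prod.fst = as := by
  induction as generalizing t x with
  | nil => rfl
  | cons a as ih => simp [earliest, ih]

theorem executable_earliest (t : ℝ) (x : X) (as : List (Action n)) :
    Executable o r t x (earliest o r t x as) := by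
  induction as generalizing t x with
  | nil => trivial
  | cons a as ih => exact ⟨le_max_left _ _, le_max_right _ _, ih _ _⟩

theorem finishTime_earliest_le {t t' : ℝ} {x : X} {as : List (Action n × ℝ)}
    (h : Executable o r t x as) (ht : t' ≤ t) :
    finishTime t' (earliest o r t' x (as.map Prod.fst)) ≤ finishTime t as := by
  induction as generalizing t t' x with
  | nil => exact ht
  | cons e as ih =>
    obtain ⟨a, s⟩ := e
    obtain ⟨h1, h2, h3⟩ := h
    exact ih h3 (max_le (by linarith) h2)

/-! ### The offline optimum -/

theorem opt_le {A : Finset (Fin n)} {as : List (Action n × ℝ)}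
    (hs : Serves c A ∅ (as.map Prod.fst)) (he : Executable o r 0 o as) :
    opt c o r A ≤ finishTime 0 as := by
  refine csInf_le ⟨0, ?_⟩ ⟨as, hs, he, rfl⟩
  rintro T ⟨bs, -, hb, rfl⟩
  have := le_finishTime_of_executable hb
  have := routeLength_nonneg (o := o) (r := r) o (bs.map Prod.fst)
  linarith

/-- The offline optimum is attained: only finitely many orders of the actions are possible, and
each of them is best carried out as early as possible. -/
theorem exists_optimal (hc : 1 ≤ c) (o : X) (r : Fin n → Request X) (A : Finset (Fin n)) :
    ∃ as : List (Action n × ℝ), Serves c A ∅ (as.map Prod.fst) ∧ Executable o r 0 o as ∧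
      finishTime 0 as = opt c o r A := by
  obtain ⟨as, has, hmin⟩ := Set.exists_min_image {as | Serves c A ∅ as}
    (fun as => finishTime 0 (earliest o r 0 o as)) (Serves.finite_setOf c A ∅)
    (Serves.exists_of_one_le hc A)
  have hs : Serves c A ∅ ((earliest o r 0 o as).map Prod.fst) := by
    rw [map_fst_earliest]
    exact has
  refine ⟨earliest o r 0 o as, hs, executable_earliest _ _ _,
    le_antisymm ?_ (opt_le hs (executable_earliest _ _ _))⟩
  refine le_csInf ⟨_, _, hs, executable_earliest _ _ _, rfl⟩ ?_
  rintro T ⟨bs, hb, hb', rfl⟩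
  exact (hmin _ hb).trans (finishTime_earliest_le hb' le_rfl)

theorem Serves.filter_map_fst {A R : Finset (Fin n)} {as : List (Action n × ℝ)}
    (hs : Serves c A ∅ (as.map Prod.fst)) (hR : R ⊆ A) :
    Serves c R ∅ ((as.filter (Action.concerns R ∘ Prod.fst)).map Prod.fst) := by
  have := hs.filter R
  rwa [List.filter_map, Finset.empty_inter, Finset.inter_eq_right.2 hR] at this

theorem opt_mono (hc : 1 ≤ c) {A B : Finset (Fin n)} (h : A ⊆ B) :
    opt c o r A ≤ opt c o r B := by
  obtain ⟨as, hs, he, hf⟩ := exists_optimal hc o r B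
  rw [← hf]
  exact (opt_le (hs.filter_map_fst h) (he.sublist List.filter_sublist)).trans
    (finishTime_le_of_sublist List.filter_sublist he le_rfl)

theorem opt_nonneg (hc : 1 ≤ c) (A : Finset (Fin n)) : 0 ≤ opt c o r A := by
  obtain ⟨as, hs, he, hf⟩ := exists_optimal hc o r A
  have := le_finishTime_of_executable he
  have := routeLength_nonneg (o := o) (r := r) o (as.map Prod.fst)
  linarith

theorem exists_serves_routeLength_le_opt (hc : 1 ≤ c) {A R : Finset (Fin n)} (h : R ⊆ A) :
    ∃ as, Serves c R ∅ as ∧ routeLength o r o as ≤ opt c o r A := by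
  obtain ⟨as, hs, he, hf⟩ := exists_optimal hc o r A
  have h1 := le_finishTime_of_executable (he.sublist (List.filter_sublist
    (p := Action.concerns R ∘ Prod.fst)))
  have h2 := finishTime_le_of_sublist (List.filter_sublist
    (p := Action.concerns R ∘ Prod.fst)) he le_rfl
  exact ⟨_, hs.filter_map_fst h, by linarith⟩

theorem exists_timed_sublist {as : List (Action n × ℝ)} {i : Fin n}
    (h : List.Sublist [.load i, .unload i] (as.map Prod.fst)) :
    ∃ s s', List.Sublist [(Action.load i, s), (.unload i, s')] as := by
  obtain ⟨bs, hb, he⟩ := List.sublist_map_iff.1 h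
  match bs, he with
  | [(a, s), (b, s')], he =>
    simp only [List.map_cons, List.map_nil, List.cons.injEq, and_true] at he
    obtain ⟨rfl, rfl⟩ := he
    exact ⟨s, s', hb⟩

theorem release_le_opt (hc : 1 ≤ c) {A : Finset (Fin n)} {i : Fin n} (hi : i ∈ A) :
    (r i).release ≤ opt c o r A := by
  obtain ⟨as, hs, he, hf⟩ := exists_optimal hc o r A
  obtain ⟨s, s', h⟩ := exists_timed_sublist (hs.load_unload_sublist hi)
  have h1 := he.sublist h
  have h2 := finishTime_le_of_sublist h he le_rfl
  obtain ⟨-, h3, h4, -⟩ := h1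
  have := dist_nonneg (x := (Action.load i).place o r) (y := (Action.unload i).place o r)
  simp only [finishTime, Action.allowedFrom] at *
  linarith

theorem dist_target_le_opt (hc : 1 ≤ c) {A : Finset (Fin n)} {i : Fin n} (hi : i ∈ A) :
    dist o (r i).target ≤ opt c o r A := by
  obtain ⟨as, hs, hl⟩ := exists_serves_routeLength_le_opt (o := o) (r := r) hc (subset_refl A)
  have h := dist_add_dist_routeEnd_le (o := o) (r := r)
    (hs.unload_mem_iff.2 (Finset.mem_union_left _ hi)) o
  simp only [Action.place] at h
  linarith [dist_nonneg (x := (r i).target) (y := routeEnd o r o as)]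

theorem exists_isShortestSchedule (hc : 1 ≤ c) (R : Finset (Fin n)) (x : X) :
    ∃ as, IsShortestSchedule c o r R x as := by
  obtain ⟨as, h, hmin⟩ := Set.exists_min_image {as | Serves c R ∅ as} (routeLength o r x)
    (Serves.finite_setOf c R ∅) (Serves.exists_of_one_le hc R)
  exact ⟨as, h, hmin⟩

theorem exists_isFastestDelivery (c : ℕ∞) (L : Finset (Fin n)) (x : X) :
    ∃ as, IsFastestDelivery c o r L x as := by
  obtain ⟨as, h, hmin⟩ := Set.exists_min_image {as | Serves c ∅ L as}
    (fun as => routeLength o r x (as ++ [.home]))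
    (Serves.finite_setOf c ∅ L) (Serves.exists_deliver c L)
  exact ⟨as, h, hmin⟩

end Routes

/-! ### Isometric embeddings -/

section Isometry

variable {M : Type u} {X : Type v} [MetricSpace M] [MetricSpace X] {n : ℕ} {e : M → X}

theorem executable_map_iff (he : Isometry e) (o : M) (r : Fin n → Request M) {t : ℝ} {x : M}
    {as : List (Action n × ℝ)} :
    Executable (e o) (fun i => (r i).map e) t (e x) as ↔ Executable o r t x as := by
  induction as generalizing t x with
  | nil => exact Iff.rfl
  | cons p as ih =>
    obtain ⟨a, s⟩ := p
    have hp : a.place (e o) (fun i => (r i).map e) = e (a.place o r) := by cases a <;> rfl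
    have ha : a.allowedFrom (fun i => (r i).map e) = a.allowedFrom r := by cases a <;> rfl
    simp only [Executable, hp, ha, he.dist_eq, ih]

theorem opt_map (he : Isometry e) (c : ℕ∞) (o : M) (r : Fin n → Request M)
    (A : Finset (Fin n)) : opt c (e o) (fun i => (r i).map e) A = opt c o r A := by
  simp only [opt, executable_map_iff he]

end Isometry

/-! ### The length of the next schedule -/

section Phase

variable {X : Type u} [MetricSpace X] {n : ℕ} {c : ℕ∞} {o : X} {r : Fin n → Request X}

theorem Executable.add_dist_le {t s s' : ℝ} {x : X} {a b : Action n}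
    {bs : List (Action n × ℝ)} (hb : Executable o r t x bs)
    (h : List.Sublist [(a, s), (b, s')] bs) :
    s + dist (a.place o r) (b.place o r) ≤ s' :=
  (hb.sublist h).2.2.1

theorem Executable.le_finishTime {t s : ℝ} {x : X} {a : Action n}
    {bs : List (Action n × ℝ)} (hb : Executable o r t x bs) (h : (a, s) ∈ bs) :
    s ≤ finishTime t bs :=
  finishTime_le_of_sublist (List.singleton_sublist.2 h) hb le_rfl

/-- An optimal schedule for `A`, cut where it loads the first request `i` of `R`: from the source
of `i` on, all of `R` can be served in the time that is left. -/
theorem exists_optimal_cut (hc : 1 ≤ c) (o : X) (r : Fin n → Request X) {A R : Finset (Fin n)}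
    (hR : R ⊆ A) (hne : R.Nonempty) :
    ∃ (pre post : List (Action n × ℝ)) (i : Fin n) (τ : ℝ) (cs : List (Action n)),
      i ∈ R ∧ Serves c A ∅ ((pre ++ (.load i, τ) :: post).map Prod.fst) ∧
      Executable o r 0 o (pre ++ (.load i, τ) :: post) ∧
      finishTime 0 (pre ++ (.load i, τ) :: post) = opt c o r A ∧
      Serves c R ∅ cs ∧ routeLength o r (r i).source cs ≤ opt c o r A - τ ∧
      (r i).release ≤ τ := by
  obtain ⟨bs, hs, he, hf⟩ := exists_optimal hc o r A
  have hsub : (bs.filter (Action.concerns R ∘ Prod.fst)).Sublist bs := List.filter_sublist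
  have hs' := hs.filter_map_fst hR
  have he' := he.sublist hsub
  have hf' := finishTime_le_of_sublist hsub he le_rfl
  rcases hcs : bs.filter (Action.concerns R ∘ Prod.fst) with _ | ⟨⟨a, τ⟩, cs⟩
  · rw [hcs] at hs'
    exact absurd hs'.of_nil.1 hne.ne_empty
  rw [hcs] at hs' he' hf'
  obtain ⟨pre, post, rfl, -, -, -⟩ := List.filter_eq_cons_iff.1 hcs
  obtain ⟨i, hi, rfl⟩ : ∃ i ∈ R, a = .load i := by
    simp only [List.map_cons] at hs'
    cases hs' with
    | load hi => exact ⟨_, hi, rfl⟩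
    | unload hi => simp at hi
  refine ⟨pre, post, i, τ, _, hi, hs, he, hf, hs', ?_, he'.2.1⟩
  have h := le_finishTime_of_executable he'.2.2
  simp only [finishTime, Action.place] at hf' h
  simp only [List.map_cons, routeLength, Action.place, dist_self]
  linarith

/-- What is known about a schedule of `Lazy(α)` for the requests `R`, of length `S`, that leads from
`p` to `p'` and is begun at time `t`, when the requests in `A₀` have been received. -/
structure IsPhase (α : ℝ) (c : ℕ∞) (o : X) (r : Fin n → Request X) (A₀ R : Finset (Fin n))
    (p p' : X) (t S : ℝ) : Prop where
  subset : R ⊆ A₀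
  mul_opt_le : α * opt c o r A₀ ≤ t
  finish_le : t + S ≤ (1 + α) * opt c o r A₀
  lt_release : ∀ i ∉ A₀, t < (r i).release
  exists_target : ∃ j ∈ R, (r j).target = p'
  visit : ∀ a : Action n, a.concerns R → dist p (a.place o r) + dist (a.place o r) p' ≤ S
  /-- The schedule begins in the origin and is shortest, or the requests in `R` have been released
  so late that the optimum cannot reach `p'` early. -/
  origin_or_late : (p = o ∧ ∀ bs, Serves c R ∅ bs → S ≤ routeLength o r o bs) ∨
    ∀ j ∈ R, opt c o r A₀ ≤ 2 * (r j).release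

/-- The main estimate: the requests `A \ A₀` that have been released during a schedule can be served
from its end `p'` in time. The two terms of the maximum are the times at which the next schedule may
begin: when the previous one ends, or when waiting ends. -/
theorem IsPhase.exists_serves_next (hc : 1 ≤ c) {α : ℝ} (hα : 3 * α ^ 2 = 3 * α + 2)
    (hα1 : 4 / 3 ≤ α) {A₀ A R : Finset (Fin n)} {p p' : X} {t S : ℝ}
    (h : IsPhase α c o r A₀ R p p' t S) (hA : A₀ ⊆ A) (hne : (A \ A₀).Nonempty)
    (hfar : opt c o r A ≤ 2 * α * opt c o r A₀) :
    ∃ bs, Serves c (A \ A₀) ∅ bs ∧ max (t + S) (α * opt c o r A) + routeLength o r p' bs ≤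
      (1 + α) * opt c o r A := by
  obtain ⟨hRA, ht, htS, hnew, ⟨j₀, hj₀, rfl⟩, hvisit, hstart⟩ := h
  obtain ⟨pre, post, i, τ, cs, hi, hs, he, hf, hcs, hlen, hrel⟩ :=
    exists_optimal_cut hc o r (R := A \ A₀) Finset.sdiff_subset hne
  refine ⟨cs, hcs, ?_⟩
  have hti : t < τ := (hnew i (Finset.mem_sdiff.1 hi).2).trans_le hrel
  have hτ : τ ≤ opt c o r A := hf ▸ he.le_finishTime (a := .load i) (by simp)
  have hl := routeLength_le_dist_add (o := o) (r := r) (r j₀).target (r i).source cs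
  obtain ⟨θ₀, θ, hsub⟩ := exists_timed_sublist (hs.load_unload_sublist (hA (hRA hj₀)))
  have hθ₀ : (r j₀).release ≤ θ₀ := (he.sublist hsub).2.1
  have hθ : θ₀ ≤ θ := by
    have := he.add_dist_le hsub
    linarith [dist_nonneg (x := (Action.load j₀).place o r) (y := (Action.unload j₀).place o r)]
  have hmem : (Action.unload j₀, θ) ∈ pre ++ (Action.load i, τ) :: post := hsub.subset (by simp)
  have before {a : Action n} {s : ℝ} (h : (a, s) ∈ pre) :
      s + dist (a.place o r) (r i).source ≤ τ :=
    he.add_dist_le (b := .load i)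
      ((List.singleton_sublist.2 h).append (List.singleton_sublist.2 List.mem_cons_self))
  have after {a : Action n} {s : ℝ} (h : (a, s) ∈ post) :
      τ + dist (r i).source (a.place o r) ≤ s :=
    he.add_dist_le (a := .load i)
      (((List.singleton_sublist.2 h).cons_cons _).trans (List.sublist_append_right _ _))
  have hO := opt_nonneg (o := o) (r := r) hc A₀
  set O := opt c o r A₀
  set O' := opt c o r A
  set D := dist (r j₀).target (r i).source
  have hxO : 4 / 3 * O ≤ α * O := by gcongr
  have hSO : S ≤ O := by linarith
  -- Both gaps come from `α * (α - 1) = 2 / 3` and `α * O ≤ t < O'`.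
  have hgap : 2 / 3 * O ≤ α * O' - O' := by nlinarith
  have hgap' : 2 / 3 * O ≤ α * O' - t := by nlinarith
  suffices h : D ≤ τ ∧ t + S + D - τ ≤ α * O' by
    rw [max_add]
    exact max_le (by linarith [h.2]) (by linarith [h.1])
  rcases List.mem_append.1 hmem with hpre | hpost
  · -- The optimum is in the target of `j₀` before it loads its first new request.
    have hD : θ + D ≤ τ := before hpre
    have hoθ : dist o (r j₀).target ≤ θ := by
      have := (he.sublist (List.singleton_sublist.2 hmem)).1
      simpa [Action.place] using this
    have h0 : 0 ≤ dist o (r j₀).target := dist_nonneg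
    refine ⟨by linarith, ?_⟩
    rcases hstart with ⟨rfl, hshort⟩ | hlate
    · -- Does the optimum still visit a place of the previous phase afterwards?
      by_cases hall : ∃ b η, (b, η) ∈ post ∧ b.concerns R
      · obtain ⟨b, η, hb, hbR⟩ := hall
        have h1 := after hb
        have h2 : η ≤ O' := hf ▸ he.le_finishTime (a := b) (by simp [hb])
        have h3 := hvisit b hbR
        have h4 := dist_triangle_left (r j₀).target (r i).source (b.place p r)
        rw [dist_comm (r i).source] at h1
        have h5 : 0 ≤ dist p (b.place p r) := dist_nonneg
        linarith
      · -- All of `R` is served before. In a violation, the schedule from the origin and that of the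
        -- optimum would have ends far from each other, yet both close to the origin.
        have hfil : (pre ++ (Action.load i, τ) :: post).filter (Action.concerns R ∘ Prod.fst) =
            pre.filter (Action.concerns R ∘ Prod.fst) := by
          have hiR : i ∉ R := fun h => (Finset.mem_sdiff.1 hi).2 (hRA h)
          have hpost : post.filter (Action.concerns R ∘ Prod.fst) = [] :=
            List.filter_eq_nil_iff.2 fun e he heR => hall ⟨e.1, e.2, he, heR⟩
          rw [List.filter_append, List.filter_cons_of_neg (by simp [Action.concerns, hiR]),
            hpost, List.append_nil]
        have hsR := hs.filter_map_fst (hRA.trans hA)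
        have hSle := hshort _ hsR
        have hfin := le_finishTime_of_executable (he.sublist (List.filter_sublist
          (p := Action.concerns R ∘ Prod.fst)))
        rw [hfil] at hsR hSle hfin
        rcases List.eq_nil_or_concat (pre.filter (Action.concerns R ∘ Prod.fst)) with
          hnil | ⟨ds, ⟨b, η⟩, hds⟩
        · rw [hnil] at hsR
          exact absurd (hsR.of_nil.1 ▸ hj₀) (by simp)
        have hbη : (b, η) ∈ pre.filter (Action.concerns R ∘ Prod.fst) := by simp [hds]
        rw [List.mem_filter] at hbη
        have h1 := before hbη.1
        have h2 := hvisit b hbη.2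
        have h3 : finishTime 0 (pre.filter (Action.concerns R ∘ Prod.fst)) = η := by
          rw [hds, List.concat_eq_append, finishTime_append]
          rfl
        have h4 := dist_triangle_left (r j₀).target (r i).source (b.place p r)
        have h5 := dist_triangle_left (b.place p r) (r j₀).target p
        by_contra! hcon
        linarith
    · linarith [hlate j₀ hj₀]
  · rcases List.mem_cons.1 hpost with heq | hpost
    · simp at heq
    · have h1 := after hpost
      have h2 : θ ≤ O' := hf ▸ he.le_finishTime hmem
      rw [dist_comm] at h1
      have h3 : dist ((Action.unload j₀).place o r) (r i).source = D := rfl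
      exact ⟨by linarith, by linarith⟩

end Phase

/-! ### Executions end -/

section Run

variable {X : Type u} [MetricSpace X] {n : ℕ} {c : ℕ∞} {o : X} {r : Fin n → Request X} {α : ℝ}
  {s s' : ServerState X n}

/-- The server has received all requests released before the present time, and none that is released
later; those released at this very moment may still have to be received. -/
structure ServerState.Timely (r : Fin n → Request X) (s : ServerState X n) : Prop where
  le_release : ∀ i ∉ s.seen, s.time ≤ (r i).release
  release_le : ∀ i ∈ s.seen, (r i).release ≤ s.time

omit [MetricSpace X] in
theorem mem_released {t : ℝ} {i : Fin n} : i ∈ released r t ↔ (r i).release ≤ t := by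
  simp [released]

omit [MetricSpace X] in
theorem ServerState.Timely.seen_subset (h : s.Timely r) : s.seen ⊆ released r s.time :=
  fun i hi => mem_released.2 (h.release_le i hi)

omit [MetricSpace X] in
theorem ServerState.Timely.receive (s : ServerState X n) (plan : List (Action n)) :
    ({ s with seen := released r s.time, plan := plan } : ServerState X n).Timely r :=
  ⟨fun _ hi => (not_le.1 fun h => hi (mem_released.2 h)).le, fun _ hi => mem_released.1 hi⟩

theorem ServerState.Timely.step (h : s.Timely r) (hs : LazyStep α c o r s s') : s'.Timely r := by
  cases hs with
  | deliverAndReturn => exact .receive s _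
  | carryOn => exact .receive s _
  | arrive a as hplan hquiet =>
    exact ⟨hquiet, fun i hi => (h.release_le i hi).trans (le_add_of_nonneg_right dist_nonneg)⟩
  | travel a as t z hplan hnext hlt =>
    exact ⟨hnext.2, fun i hi => (h.release_le i hi).trans hlt.le⟩
  | wait t hplan hnext hlt =>
    exact ⟨hnext.2, fun i hi => (h.release_le i hi).trans hlt.le⟩
  | start as hplan hquiet =>
    exact ⟨fun i hi => (hquiet i hi).le, fun i hi => (h.release_le i hi).trans (le_max_left _ _)⟩

open Classical in
/-- The unserved requests that the current plan does not serve. -/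
noncomputable def ServerState.unplanned (s : ServerState X n) : Finset (Fin n) :=
  s.unserved.filter fun i => Action.unload i ∉ s.plan

open Classical in
/-- The requests released after the present time and not yet received. -/
noncomputable def ServerState.future (r : Fin n → Request X) (s : ServerState X n) :
    Finset (Fin n) :=
  s.seenᶜ.filter fun i => s.time < (r i).release

/-- A measure that decreases with every step: receiving a request, starting a schedule, carrying out
an action and advancing to the next release decrease its four components, in this order. -/
noncomputable def ServerState.measure (r : Fin n → Request X) (s : ServerState X n) :
    ℕ ×ₗ ℕ ×ₗ ℕ ×ₗ ℕ :=
  toLex (s.seenᶜ.card, toLex (s.unplanned.card, toLex (s.plan.length, (s.future r).card)))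

omit [MetricSpace X] in
theorem ServerState.measure_advance {t : ℝ} (z : X) (hnext : s.IsNextRelease r t)
    (hlt : s.time < t) :
    ({ s with time := t, pos := z } : ServerState X n).measure r < s.measure r := by
  obtain ⟨⟨i, hi, hit⟩, -⟩ := hnext
  have : (({ s with time := t, pos := z } : ServerState X n).future r).card <
      (s.future r).card := by
    refine Finset.card_lt_card (Finset.ssubset_iff_of_subset ?_ |>.2 ⟨i, ?_, ?_⟩)
    · intro j
      simp only [ServerState.future, Finset.mem_filter]
      exact fun h => ⟨h.1, hlt.trans h.2⟩
    · simp [ServerState.future, hi, hit, hlt]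
    · simp [ServerState.future, hit]
  simp only [ServerState.measure, Prod.Lex.toLex_lt_toLex]
  exact .inr ⟨trivial, .inr ⟨rfl, .inr ⟨trivial, this⟩⟩⟩

omit [MetricSpace X] in
theorem ServerState.Timely.card_lt (h : s.Timely r)
    (hnew : ∃ i, i ∉ s.seen ∧ (r i).release ≤ s.time) :
    (released r s.time)ᶜ.card < s.seenᶜ.card := by
  obtain ⟨i, hi, hit⟩ := hnew
  refine Finset.card_lt_card (Finset.compl_ssubset_compl.2 ?_)
  exact (Finset.ssubset_iff_of_subset h.seen_subset).2 ⟨i, mem_released.2 hit, hi⟩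

theorem LazyStep.measure_lt (h : s.Timely r) (hs : LazyStep α c o r s s') :
    s'.measure r < s.measure r := by
  cases hs with
  | deliverAndReturn as hnew =>
    simp only [ServerState.measure, Prod.Lex.toLex_lt_toLex]
    exact .inl (h.card_lt hnew)
  | carryOn hnew =>
    simp only [ServerState.measure, Prod.Lex.toLex_lt_toLex]
    exact .inl (h.card_lt hnew)
  | arrive a as hplan hquiet =>
    simp only [ServerState.measure, Prod.Lex.toLex_lt_toLex]
    refine .inr ⟨trivial, ?_⟩
    refine (lt_or_eq_of_le (Finset.card_le_card ?_)).imp id fun h => ⟨h, .inl (by simp [hplan])⟩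
    intro j
    simp only [ServerState.unplanned, ServerState.unserved, Finset.mem_filter,
      Finset.mem_sdiff, hplan]
    cases a with
    | load i => simp [ServerState.servedAfter]
    | home => simp [ServerState.servedAfter]
    | unload i =>
      simp only [ServerState.servedAfter, Finset.mem_insert, List.mem_cons, Action.unload.injEq]
      tauto
  | travel a as t z hplan hnext hlt => exact ServerState.measure_advance z hnext hlt
  | wait t hplan hnext hlt => exact ServerState.measure_advance s.pos hnext hlt
  | start as hplan hquiet hne has =>
    simp only [ServerState.measure, Prod.Lex.toLex_lt_toLex]
    refine .inr ⟨trivial, .inl ?_⟩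
    refine Finset.card_lt_card (Finset.ssubset_iff_of_subset ?_ |>.2 ?_)
    · intro j
      simp only [ServerState.unplanned, Finset.mem_filter]
      exact fun hj => absurd (has.1.unload_mem_iff.2 (Finset.mem_union_left _ hj.1)) hj.2
    · obtain ⟨j, hj⟩ := hne
      refine ⟨j, by simp [ServerState.unplanned, hj, hplan], ?_⟩
      simp only [ServerState.unplanned, Finset.mem_filter, not_and, not_not]
      exact fun _ => has.1.unload_mem_iff.2 (Finset.mem_union_left _ hj)

omit [MetricSpace X] in
theorem ServerState.exists_isNextRelease (r : Fin n → Request X) {i : Fin n} (hi : i ∉ s.seen) :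
    ∃ t, s.IsNextRelease r t := by
  obtain ⟨j, hj, hmin⟩ := Finset.exists_min_image s.seenᶜ (fun j => (r j).release)
    ⟨i, by simpa using hi⟩
  exact ⟨_, ⟨j, by simpa using hj, rfl⟩, fun k hk => hmin k (by simpa using hk)⟩

/-- `Lazy(α)` never gets stuck. -/
theorem exists_lazyStep (hX : IsGeodesicSpace X) (hc : 1 ≤ c)
    (h : ¬(s.plan = [] ∧ s.unserved = ∅ ∧ s.seen = Finset.univ)) :
    ∃ s', LazyStep α c o r s s' := by
  by_cases hnew : ∃ i, i ∉ s.seen ∧ (r i).release ≤ s.time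
  · obtain ⟨as, has⟩ := exists_isFastestDelivery (o := o) (r := r) c s.loaded s.pos
    by_cases hback : s.time + routeLength o r s.pos (as ++ [.home]) ≤
        α * opt c o r (released r s.time)
    · exact ⟨_, .deliverAndReturn s as hnew has hback⟩
    · exact ⟨_, .carryOn s hnew fun bs hbs => by linarith [has.2 bs hbs]⟩
  push Not at hnew
  rcases hplan : s.plan with _ | ⟨a, as⟩
  · by_cases hne : s.unserved = ∅
    · obtain ⟨i, hi⟩ : ∃ i, i ∉ s.seen := by
        by_contra! hall
        exact h ⟨hplan, hne, Finset.eq_univ_of_forall hall⟩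
      obtain ⟨t, ht⟩ := s.exists_isNextRelease r hi
      have hlt : s.time < t := by
        obtain ⟨j, hj, rfl⟩ := ht.1
        exact hnew j hj
      exact ⟨_, .wait s t hplan ht hlt (.inl hne)⟩
    · by_cases hquiet : ∀ i, i ∉ s.seen → max s.time (α * opt c o r s.seen) < (r i).release
      · obtain ⟨as, has⟩ := exists_isShortestSchedule (o := o) (r := r) hc s.unserved s.pos
        exact ⟨_, .start s as hplan hquiet (Finset.nonempty_iff_ne_empty.2 hne) has⟩
      · push Not at hquiet
        obtain ⟨i, hi, hit⟩ := hquiet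
        obtain ⟨t, ht⟩ := s.exists_isNextRelease r hi
        have hlt : s.time < t := by
          obtain ⟨j, hj, rfl⟩ := ht.1
          exact hnew j hj
        exact ⟨_, .wait s t hplan ht hlt (.inr ((ht.2 i hi).trans hit))⟩
  · by_cases hquiet : ∀ i, i ∉ s.seen → s.time + dist s.pos (a.place o r) ≤ (r i).release
    · exact ⟨_, .arrive s a as hplan hquiet⟩
    · push Not at hquiet
      obtain ⟨i, hi, hit⟩ := hquiet
      obtain ⟨t, ht⟩ := s.exists_isNextRelease r hi
      have hlt : s.time < t := by
        obtain ⟨j, hj, rfl⟩ := ht.1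
        exact hnew j hj
      have hle : t ≤ s.time + dist s.pos (a.place o r) := (ht.2 i hi).trans hit.le
      obtain ⟨γ, h0, h1, hγ⟩ := hX s.pos (a.place o r)
      have hd : 0 ≤ dist s.pos (a.place o r) := dist_nonneg
      have hm : t - s.time ∈ Set.Icc 0 (dist s.pos (a.place o r)) := ⟨by linarith, by linarith⟩
      refine ⟨_, .travel s a as t (γ (t - s.time)) hplan ht hlt hle ?_ ?_⟩
      · have := hγ 0 ⟨le_rfl, hd⟩ _ hm
        rwa [h0, zero_sub, abs_neg, abs_of_nonneg hm.1] at this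
      · have := hγ _ hm _ ⟨hd, le_rfl⟩
        rwa [h1, abs_of_nonpos (by linarith [hm.2]), neg_sub] at this

/-! ### The invariant of the algorithm -/

/-- The server is on its way back to the origin, and will be there by time `α * Opt`. -/
structure Returning (α : ℝ) (c : ℕ∞) (o : X) (r : Fin n → Request X) (s : ServerState X n)
    (as : List (Action n)) : Prop where
  plan_eq : s.plan = as ++ [.home]
  serves : Serves c ∅ s.loaded as
  served_subset : s.served ⊆ s.seen
  loaded_subset : s.loaded ⊆ s.seen
  back : s.time + routeLength o r s.pos s.plan ≤ α * opt c o r s.seen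

/-- The server is idle in the origin. Later than `α * Opt` this happens only if a request arrives
at this very moment. -/
structure AtHome (α : ℝ) (c : ℕ∞) (o : X) (r : Fin n → Request X) (s : ServerState X n) :
    Prop where
  plan_eq : s.plan = []
  loaded_eq : s.loaded = ∅
  pos_eq : s.pos = o
  served_subset : s.served ⊆ s.seen
  time_le : s.time ≤ α * opt c o r s.seen ∨ ∃ i ∉ s.seen, (r i).release ≤ s.time

/-- The server follows the schedule of a phase, or is idle after it; it has yet to load `W`. If
requests have been received since the phase began, the server could not return to the origin in
time, which bounds the optimum by `2 * α` times its value at the beginning. -/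
structure Away (α : ℝ) (c : ℕ∞) (o : X) (r : Fin n → Request X) (A₀ R : Finset (Fin n))
    (p p' : X) (t S : ℝ) (W : Finset (Fin n)) (s : ServerState X n) : Prop where
  phase : IsPhase α c o r A₀ R p p' t S
  subset : A₀ ⊆ s.seen
  far : s.seen ≠ A₀ → opt c o r s.seen ≤ 2 * α * opt c o r A₀
  serves : Serves c W s.loaded s.plan
  disjoint : Disjoint W s.loaded
  union_eq : s.served ∪ (W ∪ s.loaded) = A₀
  routeEnd_eq : routeEnd o r s.pos s.plan = p'
  time_le : s.time + routeLength o r s.pos s.plan ≤ t + S ∨ s.plan = [] ∧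
    (s.time ≤ α * opt c o r s.seen ∨ ∃ i ∉ s.seen, (r i).release ≤ s.time)

/-- The invariant of all executions of `Lazy(α)`. -/
inductive LazyInvariant (α : ℝ) (c : ℕ∞) (o : X) (r : Fin n → Request X)
    (s : ServerState X n) : Prop
  | returning {as : List (Action n)} (h : Returning α c o r s as)
  | atHome (h : AtHome α c o r s)
  | away {A₀ R W : Finset (Fin n)} {p p' : X} {t S : ℝ} (h : Away α c o r A₀ R p p' t S W s)

theorem LazyInvariant.subset_seen (h : LazyInvariant α c o r s) :
    s.served ⊆ s.seen ∧ s.loaded ⊆ s.seen := by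
  cases h with
  | returning h => exact ⟨h.served_subset, h.loaded_subset⟩
  | atHome h => exact ⟨h.served_subset, by simp [h.loaded_eq]⟩
  | away h =>
    have := h.subset
    rw [← h.union_eq, Finset.union_subset_iff, Finset.union_subset_iff] at this
    exact ⟨this.1, this.2.2⟩

theorem LazyInvariant.deliverAndReturn (h : LazyInvariant α c o r s) (ht : s.Timely r)
    {as : List (Action n)} (has : IsFastestDelivery c o r s.loaded s.pos as)
    (hback : s.time + routeLength o r s.pos (as ++ [.home]) ≤
      α * opt c o r (released r s.time)) :
    LazyInvariant α c o r { s with seen := released r s.time, plan := as ++ [.home] } :=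
  .returning ⟨rfl, has.1, h.subset_seen.1.trans ht.seen_subset,
    h.subset_seen.2.trans ht.seen_subset, hback⟩

/-- At the time of a release, the time is at most the optimum. -/
theorem ServerState.Timely.time_le_opt (h : s.Timely r) (hc : 1 ≤ c)
    (hnew : ∃ i, i ∉ s.seen ∧ (r i).release ≤ s.time) :
    s.time ≤ opt c o r (released r s.time) := by
  obtain ⟨i, hi, hit⟩ := hnew
  exact (h.le_release i hi).trans (release_le_opt hc (mem_released.2 hit))

theorem AtHome.not_late (h : AtHome α c o r s) (hc : 1 ≤ c) (hα : 1 ≤ α) (ht : s.Timely r)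
    (hnew : ∃ i, i ∉ s.seen ∧ (r i).release ≤ s.time)
    (hlate : ∀ as, Serves c ∅ s.loaded as →
      α * opt c o r (released r s.time) < s.time + routeLength o r s.pos (as ++ [.home])) :
    False := by
  have h1 := hlate [] (by rw [h.loaded_eq]; exact .done)
  have h2 := ht.time_le_opt (o := o) hc hnew
  have h3 := opt_nonneg (o := o) (r := r) hc (released r s.time)
  simp only [h.pos_eq, List.nil_append, routeLength, Action.place, dist_self] at h1
  nlinarith

theorem Returning.not_late {as : List (Action n)} (h : Returning α c o r s as) (hc : 1 ≤ c)
    (hα : 0 ≤ α) (ht : s.Timely r)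
    (hlate : ∀ as, Serves c ∅ s.loaded as →
      α * opt c o r (released r s.time) < s.time + routeLength o r s.pos (as ++ [.home])) :
    False := by
  have h1 := hlate as h.serves
  have h2 := h.back
  rw [h.plan_eq] at h2
  have h3 := mul_le_mul_of_nonneg_left (opt_mono (o := o) (r := r) hc ht.seen_subset) hα
  linarith

theorem IsPhase.dist_end_le {A₀ R : Finset (Fin n)} {p p' : X} {t S : ℝ}
    (h : IsPhase α c o r A₀ R p p' t S) (hc : 1 ≤ c) : dist p' o ≤ opt c o r A₀ := by
  obtain ⟨j, hj, rfl⟩ := h.exists_target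
  rw [dist_comm]
  exact dist_target_le_opt hc (h.subset hj)

theorem Away.carryOn {A₀ R W : Finset (Fin n)} {p p' : X} {t S : ℝ}
    (h : Away α c o r A₀ R p p' t S W s) (hc : 1 ≤ c)
    (hα : 3 * α ^ 2 = 3 * α + 2) (hα1 : 4 / 3 ≤ α) (ht : s.Timely r)
    (hnew : ∃ i, i ∉ s.seen ∧ (r i).release ≤ s.time)
    (hlate : ∀ as, Serves c ∅ s.loaded as →
      α * opt c o r (released r s.time) < s.time + routeLength o r s.pos (as ++ [.home])) :
    Away α c o r A₀ R p p' t S W { s with seen := released r s.time } := by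
  have hsub := h.subset.trans ht.seen_subset
  have htime := ht.time_le_opt (o := o) hc hnew
  have hO := opt_nonneg (o := o) (r := r) hc A₀
  have hO' := opt_nonneg (o := o) (r := r) hc (released r s.time)
  have hp := h.phase.dist_end_le hc
  have hf := h.phase.finish_le
  -- What is on board can be delivered by following the plan without its further loads.
  have hd : ∃ bs, Serves c ∅ s.loaded bs ∧ bs.Sublist s.plan := by
    refine ⟨s.plan.filter (Action.concerns s.loaded), ?_, List.filter_sublist⟩
    have := h.serves.filter s.loaded
    rwa [Finset.inter_self, Finset.disjoint_iff_inter_eq_empty.1 h.disjoint] at this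
  obtain ⟨bs, hbs, hbp⟩ := hd
  have h1 := hlate bs hbs
  have h2 : routeLength o r s.pos (bs ++ [.home]) ≤
      routeLength o r s.pos s.plan + dist p' o := by
    have := routeLength_le_of_sublist (o := o) (r := r) (hbp.append_right [.home]) s.pos
    rw [routeLength_append _ s.plan, h.routeEnd_eq] at this
    simpa [routeLength, Action.place] using this
  have hα0 : 0 < α := by linarith
  refine ⟨h.phase, hsub, fun _ => ?_, h.serves, h.disjoint, h.union_eq, h.routeEnd_eq, ?_⟩
  · rcases h.time_le with h3 | ⟨h3, -⟩
    · -- The detour by way of the end of the schedule takes until `t + S + dist p' o`.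
      have h4 : α * opt c o r (released r s.time) ≤ α * (2 * α * opt c o r A₀) := by nlinarith
      exact le_of_mul_le_mul_left h4 hα0
    · -- The server is idle in `p'`, and the time is at most the new optimum.
      rw [h3] at h2
      simp only [routeLength] at h2
      by_contra! h4
      have h4' : opt c o r A₀ * (2 * α) < opt c o r (released r s.time) := by
        linarith
      nlinarith
  · refine h.time_le.imp id fun h3 => ⟨h3.1, .inl ?_⟩
    change s.time ≤ α * opt c o r (released r s.time)
    nlinarith

theorem isPhase_of_isShortestSchedule {A₀ R : Finset (Fin n)} {p : X} {t : ℝ}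
    {as : List (Action n)} (has : IsShortestSchedule c o r R p as) (hR : R ⊆ A₀)
    (hne : R.Nonempty) (ht : α * opt c o r A₀ ≤ t)
    (htS : t + routeLength o r p as ≤ (1 + α) * opt c o r A₀)
    (hquiet : ∀ i ∉ A₀, t < (r i).release)
    (hor : p = o ∨ ∀ j ∈ R, opt c o r A₀ ≤ 2 * (r j).release) :
    IsPhase α c o r A₀ R p (routeEnd o r p as) t (routeLength o r p as) where
  subset := hR
  mul_opt_le := ht
  finish_le := htS
  lt_release := hquiet
  exists_target := by
    obtain ⟨j, hj, he⟩ := has.1.routeEnd_eq_target (o := o) (r := r) (by simpa using hne) p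
    exact ⟨j, by simpa using hj, he.symm⟩
  visit a ha := by
    refine dist_add_dist_routeEnd_le ?_ p
    cases a with
    | load i => exact has.1.load_mem_iff.2 (by simpa [Action.concerns] using ha)
    | unload i => exact has.1.unload_mem_iff.2 (by simpa [Action.concerns] using ha)
    | home => simp [Action.concerns] at ha
  origin_or_late := hor.imp (fun h => ⟨h, by subst h; exact has.2⟩) id

theorem LazyInvariant.start (hR : s.served ⊆ s.seen) (hL : s.loaded = ∅)
    (hne : s.unserved.Nonempty)
    (hquiet : ∀ i, i ∉ s.seen → max s.time (α * opt c o r s.seen) < (r i).release)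
    {as : List (Action n)} (has : IsShortestSchedule c o r s.unserved s.pos as)
    (hfin : max s.time (α * opt c o r s.seen) + routeLength o r s.pos as ≤
      (1 + α) * opt c o r s.seen)
    (hor : s.pos = o ∨ ∀ j ∈ s.unserved, opt c o r s.seen ≤ 2 * (r j).release) :
    LazyInvariant α c o r
      { s with time := max s.time (α * opt c o r s.seen), plan := as } :=
  .away (W := s.unserved)
    ⟨isPhase_of_isShortestSchedule has Finset.sdiff_subset hne (le_max_right _ _) hfin hquiet hor,
      subset_rfl, fun h => absurd rfl h, by simpa [hL] using has.1, by simp [hL],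
      by simpa [hL, ServerState.unserved] using hR, rfl, .inl le_rfl⟩

theorem AtHome.start (h : AtHome α c o r s) (hc : 1 ≤ c)
    (hquiet : ∀ i, i ∉ s.seen → max s.time (α * opt c o r s.seen) < (r i).release)
    (hne : s.unserved.Nonempty)
    {as : List (Action n)} (has : IsShortestSchedule c o r s.unserved s.pos as) :
    LazyInvariant α c o r
      { s with time := max s.time (α * opt c o r s.seen), plan := as } := by
  refine .start h.served_subset h.loaded_eq hne hquiet has ?_ (.inl h.pos_eq)
  have htime : s.time ≤ α * opt c o r s.seen := by
    refine h.time_le.resolve_right ?_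
    rintro ⟨i, hi, hit⟩
    exact absurd ((le_max_left _ _).trans_lt (hquiet i hi)) (not_lt.2 hit)
  obtain ⟨bs, hbs, hlen⟩ := exists_serves_routeLength_le_opt (o := o) (r := r) hc
    (Finset.sdiff_subset : s.unserved ⊆ s.seen)
  have h1 := has.2 bs hbs
  rw [h.pos_eq] at h1 ⊢
  rw [max_eq_right htime]
  linarith

theorem Away.start {A₀ R W : Finset (Fin n)} {p p' : X} {t S : ℝ}
    (h : Away α c o r A₀ R p p' t S W s) (hc : 1 ≤ c)
    (hα : 3 * α ^ 2 = 3 * α + 2) (hα1 : 4 / 3 ≤ α) (hplan : s.plan = [])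
    (hquiet : ∀ i, i ∉ s.seen → max s.time (α * opt c o r s.seen) < (r i).release)
    (hne : s.unserved.Nonempty)
    {as : List (Action n)} (has : IsShortestSchedule c o r s.unserved s.pos as) :
    LazyInvariant α c o r
      { s with time := max s.time (α * opt c o r s.seen), plan := as } := by
  have hserves := h.serves
  rw [hplan] at hserves
  obtain ⟨hW, hL⟩ := hserves.of_nil
  have hserved : s.served = A₀ := by simpa [hW, hL] using h.union_eq
  have hun : s.unserved = s.seen \ A₀ := by rw [ServerState.unserved, hserved]
  have hpos : s.pos = p' := by simpa [hplan, routeEnd] using h.routeEnd_eq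
  have hfar := h.far fun heq => by simp [hun, heq] at hne
  have htime : s.time ≤ max (t + S) (α * opt c o r s.seen) := by
    rcases h.time_le with h1 | ⟨-, h1 | ⟨i, hi, hit⟩⟩
    · exact le_max_of_le_left (by simpa [hplan, routeLength] using h1)
    · exact le_max_of_le_right h1
    · exact absurd ((le_max_left _ _).trans_lt (hquiet i hi)) (not_lt.2 hit)
  obtain ⟨bs, hbs, hlen⟩ := h.phase.exists_serves_next hc hα hα1 h.subset (hun ▸ hne) hfar
  refine .start (hserved ▸ h.subset) hL hne hquiet has ?_ (.inr fun j hj => ?_)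
  · have h1 := has.2 bs (hun ▸ hbs)
    have h2 := max_le htime (le_max_right _ _)
    rw [hpos] at h1 ⊢
    linarith
  · rw [hun, Finset.mem_sdiff] at hj
    have h1 := h.phase.lt_release j hj.2
    have h2 := h.phase.mul_opt_le
    linarith

theorem Away.arrive {A₀ R W : Finset (Fin n)} {p p' : X} {t S : ℝ}
    (h : Away α c o r A₀ R p p' t S W s) {a : Action n} {as : List (Action n)}
    (hplan : s.plan = a :: as) :
    LazyInvariant α c o r
      { s with
        time := s.time + dist s.pos (a.place o r)
        pos := a.place o r
        loaded := s.loadedAfter a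
        served := s.servedAfter a
        plan := as } := by
  obtain ⟨time, pos, seen, loaded, served, plan⟩ := s
  have hserves := h.serves
  have hend := h.routeEnd_eq
  have htime := h.time_le.resolve_right fun h' => List.cons_ne_nil a as (hplan.symm.trans h'.1)
  have hdis := h.disjoint
  have hun := h.union_eq
  rw [hplan] at hserves hend htime
  simp only [routeLength, ← add_assoc] at htime
  dsimp only at *
  cases hserves with
  | @load _ _ i _ hi hcap hs =>
    refine .away (W := W.erase i) ⟨h.phase, h.subset, h.far, hs, ?_, ?_, hend, .inl htime⟩
    · simp only [ServerState.loadedAfter, Finset.disjoint_insert_right]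
      exact ⟨by simp, hdis.mono_left (Finset.erase_subset _ _)⟩
    · rw [← hun]
      ext j
      by_cases hij : j = i <;>
        simp [ServerState.servedAfter, ServerState.loadedAfter, hij, hi]
  | @unload _ _ i _ hi hs =>
    refine .away (W := W) ⟨h.phase, h.subset, h.far, hs, ?_, ?_, hend, .inl htime⟩
    · exact hdis.mono_right (Finset.erase_subset _ _)
    · rw [← hun]
      ext j
      by_cases hij : j = i <;>
        simp [ServerState.servedAfter, ServerState.loadedAfter, hij, hi]

theorem Returning.arrive {as' : List (Action n)} (h : Returning α c o r s as') {a : Action n}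
    {as : List (Action n)} (hplan : s.plan = a :: as) :
    LazyInvariant α c o r
      { s with
        time := s.time + dist s.pos (a.place o r)
        pos := a.place o r
        loaded := s.loadedAfter a
        served := s.servedAfter a
        plan := as } := by
  obtain ⟨time, pos, seen, loaded, served, plan⟩ := s
  have hserves := h.serves
  have htime := h.back
  have hp := h.plan_eq
  rw [hplan] at htime hp
  simp only [routeLength, ← add_assoc] at htime
  dsimp only at *
  cases as' with
  | nil =>
    simp only [List.nil_append, List.cons.injEq] at hp
    obtain ⟨rfl, rfl⟩ := hp
    simp only [routeLength, add_zero] at htime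
    exact .atHome ⟨rfl, hserves.of_nil.2, rfl, h.served_subset, .inl htime⟩
  | cons b bs =>
    simp only [List.cons_append, List.cons.injEq] at hp
    obtain ⟨rfl, rfl⟩ := hp
    cases hserves with
    | load hi => simp at hi
    | @unload _ _ i _ hi hs =>
      exact .returning ⟨rfl, hs, Finset.insert_subset (h.loaded_subset hi) h.served_subset,
        (Finset.erase_subset _ _).trans h.loaded_subset, htime⟩

theorem LazyInvariant.arrive (h : LazyInvariant α c o r s) {a : Action n}
    {as : List (Action n)} (hplan : s.plan = a :: as) :
    LazyInvariant α c o r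
      { s with
        time := s.time + dist s.pos (a.place o r)
        pos := a.place o r
        loaded := s.loadedAfter a
        served := s.servedAfter a
        plan := as } := by
  cases h with
  | returning h => exact h.arrive hplan
  | atHome h => exact absurd h.plan_eq (by simp [hplan])
  | away h => exact h.arrive hplan

theorem LazyInvariant.travel (h : LazyInvariant α c o r s) {a : Action n}
    {as : List (Action n)} {t : ℝ} {z : X} (hplan : s.plan = a :: as)
    (hz : dist z (a.place o r) = dist s.pos (a.place o r) - (t - s.time)) :
    LazyInvariant α c o r { s with time := t, pos := z } := by
  have hlen : t + routeLength o r z s.plan = s.time + routeLength o r s.pos s.plan := by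
    simp only [hplan, routeLength, hz]
    ring
  have hend : routeEnd o r z s.plan = routeEnd o r s.pos s.plan := by simp [hplan, routeEnd]
  cases h with
  | returning h =>
    exact .returning ⟨h.plan_eq, h.serves, h.served_subset, h.loaded_subset, hlen.trans_le h.back⟩
  | atHome h => exact absurd h.plan_eq (by simp [hplan])
  | away h =>
    exact .away ⟨h.phase, h.subset, h.far, h.serves, h.disjoint, h.union_eq,
      hend.trans h.routeEnd_eq,
      .inl (hlen.trans_le (h.time_le.resolve_right (by simp [hplan])))⟩

theorem LazyInvariant.wait (h : LazyInvariant α c o r s) {t : ℝ} (hplan : s.plan = [])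
    (hnext : s.IsNextRelease r t) :
    LazyInvariant α c o r { s with time := t } := by
  have hnow : ∃ i ∉ s.seen, (r i).release ≤ t := by
    obtain ⟨i, hi, hit⟩ := hnext.1
    exact ⟨i, hi, hit.le⟩
  cases h with
  | returning h => exact absurd h.plan_eq (by simp [hplan])
  | atHome h => exact .atHome ⟨h.plan_eq, h.loaded_eq, h.pos_eq, h.served_subset, .inr hnow⟩
  | away h =>
    exact .away ⟨h.phase, h.subset, h.far, h.serves, h.disjoint, h.union_eq, h.routeEnd_eq,
      .inr ⟨hplan, .inr hnow⟩⟩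

theorem LazyInvariant.step (h : LazyInvariant α c o r s) (ht : s.Timely r) (hc : 1 ≤ c)
    (hα : 3 * α ^ 2 = 3 * α + 2) (hα1 : 4 / 3 ≤ α) (hs : LazyStep α c o r s s') :
    LazyInvariant α c o r s' := by
  cases hs with
  | deliverAndReturn as hnew has hback => exact h.deliverAndReturn ht has hback
  | carryOn hnew hlate =>
    cases h with
    | returning h => exact (h.not_late hc (by linarith) ht hlate).elim
    | atHome h => exact (h.not_late hc (by linarith) ht hnew hlate).elim
    | away h => exact .away (h.carryOn hc hα hα1 ht hnew hlate)
  | arrive a as hplan hquiet => exact h.arrive hplan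
  | travel a as t z hplan hnext hlt hle hz hz' => exact h.travel hplan hz'
  | wait t hplan hnext hlt hwait => exact h.wait hplan hnext
  | start as hplan hquiet hne has =>
    cases h with
    | returning h => exact absurd h.plan_eq (by simp [hplan])
    | atHome h => exact h.start hc hquiet hne has
    | away h => exact h.start hc hα hα1 hplan hquiet hne has

theorem LazyInvariant.time_le (h : LazyInvariant α c o r s) (hc : 1 ≤ c) (hα : 0 ≤ α)
    (hplan : s.plan = []) (hseen : s.seen = Finset.univ) :
    s.time ≤ (α + 1) * opt c o r Finset.univ := by
  have hO := opt_nonneg (o := o) (r := r) hc Finset.univ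
  cases h with
  | returning h => exact absurd h.plan_eq (by simp [hplan])
  | atHome h =>
    have h1 := h.time_le
    simp only [hseen, Finset.mem_univ, not_true_eq_false, false_and, exists_false,
      or_false] at h1
    linarith
  | @away A₀ R W p p' t S h =>
    have h1 := h.time_le
    simp only [hseen, hplan, routeLength, Finset.mem_univ, not_true_eq_false, false_and,
      exists_false, or_false, add_zero, true_and] at h1
    have h2 := h.phase.finish_le
    have h3 : (1 + α) * opt c o r A₀ ≤ (1 + α) * opt c o r Finset.univ := by
      gcongr
      exact opt_mono hc (Finset.subset_univ _)
    rcases h1 with h1 | h1 <;> linarith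

theorem alwaysFinishesBy_of_invariant (hX : IsGeodesicSpace X) (hc : 1 ≤ c)
    (hα : 3 * α ^ 2 = 3 * α + 2) (hα1 : 4 / 3 ≤ α) (ht : s.Timely r)
    (h : LazyInvariant α c o r s) :
    AlwaysFinishesBy α c o r ((α + 1) * opt c o r Finset.univ) s := by
  induction hm : s.measure r using WellFoundedLT.induction generalizing s with
  | ind m ih =>
    subst hm
    by_cases hend : s.plan = [] ∧ s.unserved = ∅ ∧ s.seen = Finset.univ
    · obtain ⟨hplan, hun, hseen⟩ := hend
      refine .done s ?_ (h.time_le hc (by linarith) hplan hseen)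
      rw [ServerState.unserved, Finset.sdiff_eq_empty_iff_subset, hseen] at hun
      exact Finset.univ_subset_iff.1 hun
    · exact .step s (exists_lazyStep hX hc hend) fun s' hs =>
        ih _ (hs.measure_lt ht) (ht.step hs) (h.step ht hc hα hα1 hs) rfl

theorem alwaysFinishesBy_init (hX : IsGeodesicSpace X) (hc : 1 ≤ c)
    (hα : 3 * α ^ 2 = 3 * α + 2) (hα1 : 4 / 3 ≤ α) :
    AlwaysFinishesBy α c o r ((α + 1) * opt c o r Finset.univ) (ServerState.init o) :=
  alwaysFinishesBy_of_invariant hX hc hα hα1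
    ⟨fun i _ => (r i).release_nonneg, fun i hi => absurd hi (Finset.notMem_empty i)⟩
    (.atHome ⟨rfl, rfl, rfl, subset_rfl,
      .inl (mul_nonneg (by linarith) (opt_nonneg hc _))⟩)

theorem competitiveForAllTies (hc : 1 ≤ c) (hα : 3 * α ^ 2 = 3 * α + 2) (hα1 : 4 / 3 ≤ α) :
    CompetitiveForAllTies.{u} α c (α + 1) := by
  intro M X _ _ e he hX o n r
  rw [← opt_map he]
  exact alwaysFinishesBy_init hX hc hα hα1

theorem AlwaysFinishesBy.canFinishBy {T : ℝ} (h : AlwaysFinishesBy α c o r T s) :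
    CanFinishBy α c o r T s := by
  induction h with
  | done s hserved htime => exact ⟨s, .refl, hserved, htime⟩
  | step s hex hall ih =>
    obtain ⟨s', hs⟩ := hex
    obtain ⟨s'', h1, h2⟩ := ih s' hs
    exact ⟨s'', .head hs h1, h2⟩

theorem CompetitiveForAllTies.competitiveForBestTies {ρ : ℝ}
    (h : CompetitiveForAllTies.{u} α c ρ) : CompetitiveForBestTies.{u} α c ρ :=
  fun M X _ _ e he hX o n r => (h M X e he hX o n r).canFinishBy

end Run

/-! ### The lower bound -/

section LowerBound

/-- A single request on the real line, from `1` to `1`, released at time `0`. -/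
def unitRequest : Fin 1 → Request (ULift.{u} ℝ) := fun _ => ⟨⟨1⟩, ⟨1⟩, 0, le_rfl⟩

theorem opt_unitRequest {c : ℕ∞} (hc : 1 ≤ c) :
    opt c (⟨0⟩ : ULift.{u} ℝ) unitRequest Finset.univ = 1 := by
  apply le_antisymm
  · refine opt_le (as := [(.load 0, 1), (.unload 0, 1)]) ?_ ?_
    · refine .load (Finset.mem_univ 0) (by simpa using hc) (.unload (by simp) ?_)
      exact .done
    · simp [Executable, Action.place, unitRequest, Action.allowedFrom, ULift.dist_eq]
  · have := dist_target_le_opt (o := (⟨0⟩ : ULift.{u} ℝ)) (r := unitRequest) hc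
      (Finset.mem_univ (0 : Fin 1))
    simpa [unitRequest, ULift.dist_eq] using this

theorem released_unitRequest {t : ℝ} (ht : 0 ≤ t) :
    released unitRequest.{u} t = Finset.univ :=
  Finset.eq_univ_of_forall fun _ => mem_released.2 ht

theorem isGeodesicSpace_real : IsGeodesicSpace (ULift.{u} ℝ) := by
  rintro ⟨x⟩ ⟨y⟩
  rcases le_total x y with h | h
  · refine ⟨fun s => ⟨x + s⟩, by simp, ?_, fun s _ t _ => ?_⟩
    · simp [ULift.dist_eq, Real.dist_eq, abs_of_nonpos (sub_nonpos.2 h)]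
    · simp [ULift.dist_eq, Real.dist_eq]
  · refine ⟨fun s => ⟨x - s⟩, by simp, ?_, fun s _ t _ => ?_⟩
    · simp [ULift.dist_eq, Real.dist_eq, abs_of_nonneg (sub_nonneg.2 h)]
    · rw [ULift.dist_eq, Real.dist_eq, ← abs_neg]
      congr 1
      ring

/-- The states that `Lazy(α)` can reach on `unitRequest`: before the request is received, while the
server waits in the origin, and after it has started at time `α` or later. -/
inductive UnitInvariant (α : ℝ) (s : ServerState (ULift.{u} ℝ) 1) : Prop
  | unknown (hseen : s.seen = ∅) (hplan : s.plan = []) (hserved : s.served = ∅)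
      (hloaded : s.loaded = ∅) (hpos : s.pos = ⟨0⟩) (htime : 0 ≤ s.time)
  | waiting (hseen : s.seen = Finset.univ) (hplan : s.plan = [] ∨ s.plan = [.home])
      (hserved : s.served = ∅) (hpos : s.pos = ⟨0⟩)
  | started (hseen : s.seen = Finset.univ) (hlate : α + 1 ≤ s.time + dist s.pos ⟨1⟩)
      (hserved : s.served.Nonempty → α + 1 ≤ s.time)

theorem UnitInvariant.step {c : ℕ∞} (hc : 1 ≤ c) {α : ℝ}
    {s s' : ServerState (ULift.{u} ℝ) 1} (h : UnitInvariant α s)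
    (hs : LazyStep α c ⟨0⟩ unitRequest s s') : UnitInvariant α s' := by
  cases h with
  | unknown hseen hplan hserved hloaded hpos htime =>
    cases hs with
    | deliverAndReturn as hnew has hback =>
      refine .waiting (released_unitRequest htime) (.inr ?_) hserved hpos
      have := has.1
      rw [hloaded] at this
      simp [this.eq_nil]
    | carryOn hnew hlate =>
      exact .waiting (released_unitRequest htime) (.inl hplan) hserved hpos
    | arrive a as h => simp [hplan] at h
    | travel a as t z h => simp [hplan] at h
    | wait t _ hnext hlt =>
      obtain ⟨i, -, hi⟩ := hnext.1
      simp only [unitRequest] at hi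
      linarith
    | start as _ hquiet hne => simp [ServerState.unserved, hseen] at hne
  | waiting hseen hplan hserved hpos =>
    cases hs with
    | deliverAndReturn as hnew => simp [hseen] at hnew
    | carryOn hnew => simp [hseen] at hnew
    | arrive a as h =>
      rw [h] at hplan
      simp only [reduceCtorEq, List.cons.injEq, false_or] at hplan
      obtain ⟨rfl, rfl⟩ := hplan
      exact .waiting hseen (.inl rfl) hserved rfl
    | travel a as t z _ hnext => simp [ServerState.IsNextRelease, hseen] at hnext
    | wait t _ hnext => simp [ServerState.IsNextRelease, hseen] at hnext
    | start as =>
      refine .started hseen ?_ (by simp [hserved])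
      rw [hseen, opt_unitRequest hc, hpos]
      simp [ULift.dist_eq]
  | started hseen hlate hserved =>
    cases hs with
    | deliverAndReturn as hnew => simp [hseen] at hnew
    | carryOn hnew => simp [hseen] at hnew
    | arrive a as h =>
      have h1 := dist_triangle s.pos (a.place ⟨0⟩ unitRequest) ⟨1⟩
      have h2 : α + 1 ≤ s.time + dist s.pos (a.place ⟨0⟩ unitRequest) +
          dist (a.place ⟨0⟩ unitRequest) ⟨1⟩ := by linarith
      refine .started hseen h2 fun hne => ?_
      cases a with
      | unload i => simpa [Action.place, unitRequest] using h2
      | load i => exact (hserved hne).trans (le_add_of_nonneg_right dist_nonneg)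
      | home => exact (hserved hne).trans (le_add_of_nonneg_right dist_nonneg)
    | travel a as t z _ hnext => simp [ServerState.IsNextRelease, hseen] at hnext
    | wait t _ hnext => simp [ServerState.IsNextRelease, hseen] at hnext
    | start as =>
      exact .started hseen (hlate.trans (by gcongr; exact le_max_left _ _))
        fun hne => (hserved hne).trans (le_max_left _ _)

theorem le_of_competitiveForBestTies {c : ℕ∞} (hc : 1 ≤ c) {α ρ : ℝ}
    (h : CompetitiveForBestTies.{u} α c ρ) : α + 1 ≤ ρ := by
  obtain ⟨s, hs, hserved, htime⟩ := h (ULift.{u} ℝ) (ULift.{u} ℝ) id isometry_id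
    isGeodesicSpace_real ⟨0⟩ 1 unitRequest
  rw [opt_unitRequest hc, mul_one] at htime
  have hinv : UnitInvariant α s := by
    refine Relation.ReflTransGen.head_induction_on (motive := fun a _ => UnitInvariant α a →
      UnitInvariant α s) hs id (fun h1 _ ih h => ih (h.step hc h1)) ?_
    exact .unknown rfl rfl rfl rfl rfl le_rfl
  cases hinv with
  | unknown _ _ h => simp [h] at hserved
  | waiting _ _ h => simp [h] at hserved
  | started _ _ h => exact (h (by simp [hserved])).trans htime

end LowerBound

end DialARide

theorem theorem1 (c : ℕ∞) (hc : 1 ≤ c) (α : ℝ) (hα : α = 1 / 2 + Real.sqrt (11 / 12)) :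
    IsGLB {ρ : ℝ | 1 ≤ ρ ∧ DialARide.CompetitiveForAllTies.{u} α c ρ} (α + 1) ∧
    IsGLB {ρ : ℝ | 1 ≤ ρ ∧ DialARide.CompetitiveForBestTies.{u} α c ρ} (α + 1) ∧
    |α + 1 - 2.457| < 0.0005 := by
  have hsq : Real.sqrt (11 / 12) ^ 2 = 11 / 12 := Real.sq_sqrt (by norm_num)
  have h1 : 0.957 < Real.sqrt (11 / 12) := Real.lt_sqrt_of_sq_lt (by norm_num)
  have h2 : Real.sqrt (11 / 12) < 0.9575 := (Real.sqrt_lt' (by norm_num)).2 (by norm_num)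
  have hα2 : 3 * α ^ 2 = 3 * α + 2 := by
    rw [hα]
    linarith
  have hα1 : 4 / 3 ≤ α := by
    rw [hα]
    linarith
  have hall := DialARide.competitiveForAllTies.{u} hc hα2 hα1
  refine ⟨IsLeast.isGLB ⟨⟨by linarith, hall⟩, fun ρ hρ => ?_⟩,
    IsLeast.isGLB ⟨⟨by linarith, hall.competitiveForBestTies⟩, fun ρ hρ => ?_⟩, ?_⟩
  · exact DialARide.le_of_competitiveForBestTies hc hρ.2.competitiveForBestTies
  · exact DialARide.le_of_competitiveForBestTies hc hρ.2
  · rw [abs_lt, hα]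
    constructor <;> linarith
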